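/- Let $p\ge 1$, let $N=\mathrm{diag}(n_1,\dots,n_p)$ with all $n_j>0$ and $N^{1/2}=\mathrm{diag}(\sqrt{n_1},\dots,\sqrt{n_p})$, let $S$ be a real symmetric positive definite $p\times p$ matrix, and let $v\in\mathbb{R}$ satisfy $2v+\mathrm{tr}(N)/p>2p$. Write $|\cdot|$ for the determinant, $\mathrm{etr}(A)=\exp(\mathrm{tr}\,A)$, and $\Omega$ for the cone of real symmetric positive definite $p\times p$ matrices, equipped with Lebesgue measure $d\Sigma=\prod_{i\le j}d\sigma_{ij}$. Then, for a suitable constant $c>0$ not depending on $\Sigma$, the function $$p(\Sigma)=c\,|\Sigma|^{-\{v+\mathrm{tr}(N)/(2p)\}}\,\mathrm{etr}\left(-\tfrac12 N^{1/2}SN^{1/2}\Sigma^{-1}\right),\qquad \Sigma\in\Omega,$$ is a probability density on $\Omega$ with respect to $d\Sigma$: it is nonnegative, integrable, and $\int_\Omega p(\Sigma)\,d\Sigma=1$. Explicitly, with $m=2v+\mathrm{tr}(N)/p-p-1$, $$c=\frac{|S|^{m/2}\left(\prod_{j=1}^p n_j\right)^{m/2}}{2^{mp/2}\,\Gamma_p(m/2)},\qquad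 \Gamma_p(a)=\pi^{p(p-1)/4}\prod_{j=1}^p\Gamma\left(a-\tfrac{j-1}{2}\right).$$ -/

import Mathlib

/-- Indices `(i, j)` with `i ≤ j`: the free entries of a symmetric `p × p` matrix. -/
abbrev UpperIdx (p : ℕ) : Type := {ij : Fin p × Fin p // ij.1 ≤ ij.2}

/-- The symmetric matrix with the given entries on and above the diagonal. -/
def symMatrix {p : ℕ} (x : UpperIdx p → ℝ) : Matrix (Fin p) (Fin p) ℝ :=
  Matrix.of fun i j => x ⟨(min i j, max i j), min_le_max⟩

theorem symMatrix_isSymm {p : ℕ} (x : UpperIdx p → ℝ) : (symMatrix x).IsSymm := by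
  ext i j
  simp [symMatrix, min_comm, max_comm]

/-- Each symmetric matrix has exactly one vector of coordinates. -/
theorem existsUnique_symMatrix {p : ℕ} (A : Matrix (Fin p) (Fin p) ℝ) (hA : A.IsSymm) :
    ∃! x : UpperIdx p → ℝ, symMatrix x = A := by
  refine ⟨fun ij => A ij.1.1 ij.1.2, ?_, ?_⟩
  · ext i j
    rcases le_total i j with h | h
    · simp [symMatrix, h]
    · simpa [symMatrix, h] using hA.apply i j
  · rintro y rfl
    ext ⟨⟨i, j⟩, h⟩
    have h' : i ≤ j := h
    simp [symMatrix, h']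

/-- The cone `Ω` of positive definite matrices, in the coordinates `σ i j` with `i ≤ j`. -/
def posDefCoords (p : ℕ) : Set (UpperIdx p → ℝ) := {x | (symMatrix x).PosDef}

/-- `f` is a probability density on the cone of positive definite `p × p` matrices with respect
to Lebesgue measure `dΣ = ∏_{i ≤ j} dσ i j`. -/
structure IsPosDefDensity {p : ℕ} (f : Matrix (Fin p) (Fin p) ℝ → ℝ) : Prop where
  nonneg : ∀ A : Matrix (Fin p) (Fin p) ℝ, A.PosDef → 0 ≤ f A
  integrable : MeasureTheory.IntegrableOn (fun x => f (symMatrix x)) (posDefCoords p)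
    MeasureTheory.volume
  integral_eq_one : ∫ x in posDefCoords p, f (symMatrix x) = 1

/-- The exponential of the trace. -/
noncomputable def etr {p : ℕ} (A : Matrix (Fin p) (Fin p) ℝ) : ℝ := Real.exp A.trace

/-- The multivariate gamma function
`Γ_p(a) = π ^ (p (p - 1) / 4) ∏_{j = 1}^p Γ(a - (j - 1) / 2)`, for `a > (p - 1) / 2`. -/
noncomputable def multivariateGamma (p : ℕ) (a : ℝ) : ℝ :=
  Real.pi ^ ((p : ℝ) * ((p : ℝ) - 1) / 4) * ∏ j : Fin p, Real.Gamma (a - ((j : ℕ) : ℝ) / 2)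

/-- `N ^ (1/2)` for `N = diag(n_1, …, n_p)`. -/
noncomputable def diagSqrt {p : ℕ} (n : Fin p → ℝ) : Matrix (Fin p) (Fin p) ℝ :=
  Matrix.diagonal fun i => √(n i)

theorem diagSqrt_mul_self {p : ℕ} (n : Fin p → ℝ) (hn : ∀ i, 0 < n i) :
    diagSqrt n * diagSqrt n = Matrix.diagonal n := by
  simp [diagSqrt, Matrix.diagonal_mul_diagonal, fun i => Real.mul_self_sqrt (hn i).le]

/-- `|Σ| ^ (-(v + tr N / (2p))) etr(-½ N^{1/2} S N^{1/2} Σ⁻¹)`, where `N = diag(n_1, …, n_p)`. -/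
noncomputable def miwKernel {p : ℕ} (S : Matrix (Fin p) (Fin p) ℝ) (n : Fin p → ℝ) (v : ℝ)
    (A : Matrix (Fin p) (Fin p) ℝ) : ℝ :=
  A.det ^ (-(v + (Matrix.diagonal n).trace / (2 * (p : ℝ)))) *
    etr (-(1 / 2 : ℝ) • (diagSqrt n * S * diagSqrt n * A⁻¹))

/-- The normalizing constant of the modified inverted Wishart density:
with `m = 2v + tr N / p - p - 1`, it is
`|S|^{m/2} (∏ n_j)^{m/2} / (2^{mp/2} Γ_p(m/2))`. -/
noncomputable def miwConst {p : ℕ} (S : Matrix (Fin p) (Fin p) ℝ) (n : Fin p → ℝ) (v : ℝ) : ℝ :=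
  let m : ℝ := 2 * v + (Matrix.diagonal n).trace / (p : ℝ) - (p : ℝ) - 1
  (2 ^ (m * (p : ℝ) / 2) * multivariateGamma p (m / 2))⁻¹ * S.det ^ (m / 2) *
    (∏ j, n j) ^ (m / 2)

/-!
Scaling reduces the claim to the matrix form of Euler's integral
`∫_Ω |Σ| ^ (-(a + (p + 1) / 2)) etr(-B Σ⁻¹) dΣ = Γ_p(a) |B| ^ (-a)` with `a = m / 2` and
`B = ½ N^{1/2} S N^{1/2}`, which is proved by induction on `p`. Every positive definite matrix of
size `p + 1` is uniquely `U (t ⊕ C) Uᵀ` with `t > 0`, `C` positive definite of size `p`, and `U`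
upper unitriangular with first row `(1, w)` and all other off-diagonal entries `0`. In the
coordinates `(t, w, C)` Lebesgue measure has density `|C|`. Since the matrices `U` form a group
isomorphic to `ℝᵖ`, writing `B` as `U₀ (b ⊕ D) U₀ᵀ` gives
`tr(B Σ⁻¹) = t⁻¹ (b + (w - w₀)ᵀ D (w - w₀)) + tr(D C⁻¹)`, so the integral over `w` is Gaussian, the
integral over `t` is a gamma integral after `t ↦ t⁻¹`, and the integral over `C` is the one for
`a - 1 / 2` and `D`.
-/

open Matrix MeasureTheory

section Border

variable {R : Type*} {p : ℕ}

/-- The matrix with corner entry `a`, first row `r`, first column `c` and remaining block `M`.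
It plays the role of `Matrix.fromBlocks`, but is indexed by `Fin (p + 1)`. -/
def border (a : R) (r c : Fin p → R) (M : Matrix (Fin p) (Fin p) R) :
    Matrix (Fin (p + 1)) (Fin (p + 1)) R :=
  Matrix.of (Fin.cons (Fin.cons a r) fun i => Fin.cons (c i) (M i))

section Entries

variable (a : R) (r c : Fin p → R) (M : Matrix (Fin p) (Fin p) R)

@[simp] theorem border_zero_zero : border a r c M 0 0 = a := rfl

@[simp] theorem border_zero_succ (j : Fin p) : border a r c M 0 j.succ = r j := rfl

@[simp] theorem border_succ_zero (i : Fin p) : border a r c M i.succ 0 = c i := rfl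

@[simp] theorem border_succ_succ (i j : Fin p) : border a r c M i.succ j.succ = M i j := rfl

theorem submatrix_succ_border : (border a r c M).submatrix Fin.succ Fin.succ = M := rfl

theorem transpose_border : (border a r c M)ᵀ = border a c r Mᵀ := by
  ext i j
  cases i using Fin.cases <;> cases j using Fin.cases <;> rfl

end Entries

theorem border_submatrix_succ (B : Matrix (Fin (p + 1)) (Fin (p + 1)) R) :
    border (B 0 0) (fun j => B 0 j.succ) (fun i => B i.succ 0) (B.submatrix Fin.succ Fin.succ) =
      B := by
  ext i j
  cases i using Fin.cases <;> cases j using Fin.cases <;> rfl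

section CommRing

variable [CommRing R] (a : R) (r c : Fin p → R) (M : Matrix (Fin p) (Fin p) R)

theorem border_mul_border (a' : R) (r' c' : Fin p → R) (M' : Matrix (Fin p) (Fin p) R) :
    border a r c M * border a' r' c' M' =
      border (a * a' + r ⬝ᵥ c') (a • r' + r ᵥ* M') (a' • c + M *ᵥ c')
        (vecMulVec c r' + M * M') := by
  ext i j
  cases i using Fin.cases <;> cases j using Fin.cases <;>
    simp [Matrix.mul_apply, Fin.sum_univ_succ, dotProduct, vecMul, mulVec, vecMulVec_apply,
      mul_comm]

theorem border_one : border 1 0 0 (1 : Matrix (Fin p) (Fin p) R) = 1 := by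
  ext i j
  cases i using Fin.cases <;> cases j using Fin.cases <;>
    simp [Matrix.one_apply, Fin.succ_ne_zero, (Fin.succ_ne_zero _).symm]

theorem trace_border : (border a r c M).trace = a + M.trace :=
  Fin.sum_univ_succ _

theorem det_border_zero : (border a r 0 M).det = a * M.det := by
  rw [det_succ_column_zero, Fin.sum_univ_succ]
  simp only [border_succ_zero, Pi.zero_apply, mul_zero, zero_mul, Finset.sum_const_zero, add_zero,
    Fin.val_zero, pow_zero, one_mul, border_zero_zero, Fin.succAbove_zero, submatrix_succ_border]

end CommRing

theorem inv_border_zero_zero {K : Type*} [Field K] {t : K} {C : Matrix (Fin p) (Fin p) K}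
    (ht : t ≠ 0) (hC : IsUnit C.det) : (border t 0 0 C)⁻¹ = border t⁻¹ 0 0 C⁻¹ := by
  refine inv_eq_right_inv ?_
  simp [border_mul_border, mul_inv_cancel₀ ht, mul_nonsing_inv _ hC, border_one]

theorem posDef_border_zero_zero_iff {t : ℝ} {C : Matrix (Fin p) (Fin p) ℝ} :
    (border t 0 0 C).PosDef ↔ 0 < t ∧ C.PosDef := by
  refine ⟨fun h => ⟨h.diag_pos (i := 0), h.submatrix (Fin.succ_injective p)⟩, ?_⟩
  rintro ⟨ht, hC⟩
  have isHermitian : (border t 0 0 C).IsHermitian := by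
    rw [isHermitian_iff_isSymm, IsSymm, transpose_border, isHermitian_iff_isSymm.1 hC.isHermitian]
  have quadraticForm (x : Fin (p + 1) → ℝ) : star x ⬝ᵥ border t 0 0 C *ᵥ x =
      t * x 0 ^ 2 + Fin.tail x ⬝ᵥ C *ᵥ Fin.tail x := by
    simp only [dotProduct, Pi.star_apply, star_trivial, mulVec, Fin.sum_univ_succ,
      border_zero_zero, border_zero_succ, border_succ_zero, border_succ_succ, Pi.zero_apply,
      zero_mul, Finset.sum_const_zero, add_zero, zero_add, Fin.tail]
    ring
  have posSemidef : (border t 0 0 C).PosSemidef := by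
    refine .of_dotProduct_mulVec_nonneg isHermitian fun x => ?_
    have tail_nonneg : 0 ≤ Fin.tail x ⬝ᵥ C *ᵥ Fin.tail x :=
      hC.posSemidef.dotProduct_mulVec_nonneg (Fin.tail x)
    rw [quadraticForm]
    positivity
  rw [posSemidef.posDef_iff_det_ne_zero, det_border_zero]
  exact mul_ne_zero ht.ne' hC.det_pos.ne'

end Border

section Shear

variable {R : Type*} [CommRing R] {p : ℕ}

/-- The upper unitriangular matrix with first row `(1, w)` that differs from the identity only in
this row; conjugation by it clears the first row and column of a symmetric matrix. -/
def shear (w : Fin p → R) : Matrix (Fin (p + 1)) (Fin (p + 1)) R := border 1 w 0 1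

theorem shear_mul_shear (u w : Fin p → R) : shear u * shear w = shear (u + w) := by
  simp [shear, border_mul_border, add_comm]

theorem det_shear (w : Fin p → R) : (shear w).det = 1 := by
  simp [shear, det_border_zero]

theorem inv_shear (w : Fin p → R) : (shear w)⁻¹ = shear (-w) := by
  refine inv_eq_right_inv ?_
  rw [shear_mul_shear, add_neg_cancel]
  exact border_one

/-- The congruence `U (t ⊕ C) Uᵀ` of a block diagonal matrix by `U = shear w`. If `C` is
invertible, `t` is its Schur complement with respect to the block `C`. -/
def schurMatrix (t : R) (w : Fin p → R) (C : Matrix (Fin p) (Fin p) R) :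
    Matrix (Fin (p + 1)) (Fin (p + 1)) R :=
  shear w * border t 0 0 C * (shear w)ᵀ

theorem schurMatrix_eq_border (t : R) (w : Fin p → R) (C : Matrix (Fin p) (Fin p) R) :
    schurMatrix t w C = border (t + w ⬝ᵥ C *ᵥ w) (w ᵥ* C) (C *ᵥ w) C := by
  simp [schurMatrix, shear, transpose_border, border_mul_border, dotProduct_mulVec]

theorem det_schurMatrix (t : R) (w : Fin p → R) (C : Matrix (Fin p) (Fin p) R) :
    (schurMatrix t w C).det = t * C.det := by
  simp [schurMatrix, det_shear, det_border_zero]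

theorem shear_mul_schurMatrix_mul_transpose (u : Fin p → R) (t : R) (w : Fin p → R)
    (C : Matrix (Fin p) (Fin p) R) :
    shear u * schurMatrix t w C * (shear u)ᵀ = schurMatrix t (u + w) C := by
  simp only [schurMatrix, ← shear_mul_shear, transpose_mul, Matrix.mul_assoc]

theorem inv_schurMatrix {K : Type*} [Field K] {t : K} (w : Fin p → K)
    {C : Matrix (Fin p) (Fin p) K} (ht : t ≠ 0) (hC : IsUnit C.det) :
    (schurMatrix t w C)⁻¹ = (shear (-w))ᵀ * border t⁻¹ 0 0 C⁻¹ * shear (-w) := by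
  rw [schurMatrix, Matrix.mul_inv_rev, Matrix.mul_inv_rev, ← transpose_nonsing_inv, inv_shear,
    inv_border_zero_zero ht hC, Matrix.mul_assoc]

/-- Cycling the trace moves both shears onto the same factor, where they combine to
`shear (w₀ - w)`. -/
theorem trace_schurMatrix_mul_inv_schurMatrix {K : Type*} [Field K] (b : K) {t : K}
    (w₀ w : Fin p → K) (D : Matrix (Fin p) (Fin p) K) {C : Matrix (Fin p) (Fin p) K}
    (ht : t ≠ 0) (hC : IsUnit C.det) :
    (schurMatrix b w₀ D * (schurMatrix t w C)⁻¹).trace =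
      (b + (w - w₀) ⬝ᵥ D *ᵥ (w - w₀)) / t + (D * C⁻¹).trace := by
  calc (schurMatrix b w₀ D * (schurMatrix t w C)⁻¹).trace
      = (shear (-w) * schurMatrix b w₀ D * (shear (-w))ᵀ * border t⁻¹ 0 0 C⁻¹).trace := by
        rw [inv_schurMatrix w ht hC, ← Matrix.mul_assoc, trace_mul_comm]
        simp only [Matrix.mul_assoc]
    _ = (schurMatrix b (-(w - w₀)) D * border t⁻¹ 0 0 C⁻¹).trace := by
        rw [shear_mul_schurMatrix_mul_transpose, neg_sub, neg_add_eq_sub]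
    _ = (b + (w - w₀) ⬝ᵥ D *ᵥ (w - w₀)) / t + (D * C⁻¹).trace := by
        rw [schurMatrix_eq_border, border_mul_border, trace_border, mulVec_neg,
          neg_dotProduct_neg]
        simp [div_eq_mul_inv]

theorem posDef_schurMatrix_iff {t : ℝ} {w : Fin p → ℝ} {C : Matrix (Fin p) (Fin p) ℝ} :
    (schurMatrix t w C).PosDef ↔ 0 < t ∧ C.PosDef := by
  have isUnit_shear : IsUnit (shear w) := by
    simp [isUnit_iff_isUnit_det, det_shear]
  rw [schurMatrix, ← conjTranspose_eq_transpose_of_trivial, ← star_eq_conjTranspose,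
    isUnit_shear.posDef_star_right_conjugate_iff, posDef_border_zero_zero_iff]

theorem exists_eq_schurMatrix {B : Matrix (Fin (p + 1)) (Fin (p + 1)) ℝ} (hB : B.PosDef) :
    ∃ (b : ℝ) (w : Fin p → ℝ) (D : Matrix (Fin p) (Fin p) ℝ),
      0 < b ∧ D.PosDef ∧ B = schurMatrix b w D := by
  set D := B.submatrix Fin.succ Fin.succ
  have hD : D.PosDef := hB.submatrix (Fin.succ_injective p)
  set c : Fin p → ℝ := fun i => B i.succ 0
  have hBsymm : B.IsSymm := isHermitian_iff_isSymm.1 hB.isHermitian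
  have hDsymm : Dᵀ = D := isHermitian_iff_isSymm.1 hD.isHermitian
  set w := D⁻¹ *ᵥ c
  have mulVec_w : D *ᵥ w = c := by
    rw [mulVec_mulVec, mul_nonsing_inv _ hD.det_pos.ne'.isUnit, one_mulVec]
  have vecMul_w : w ᵥ* D = fun j => B 0 j.succ := by
    rw [← hDsymm, vecMul_transpose, mulVec_w]
    exact funext fun j => hBsymm.apply 0 j.succ
  have hBD : B = schurMatrix (B 0 0 - w ⬝ᵥ D *ᵥ w) w D := by
    rw [schurMatrix_eq_border, sub_add_cancel, vecMul_w, mulVec_w, border_submatrix_succ]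
  exact ⟨_, w, D, (posDef_schurMatrix_iff.1 (hBD ▸ hB)).1, hD, hBD⟩

end Shear

section LinearChangeOfVariables

variable {ι : Type*} [Fintype ι] [DecidableEq ι]

theorem lintegral_comp_mulVec {M : Matrix ι ι ℝ} (hM : M.det ≠ 0) (f : (ι → ℝ) → ENNReal) :
    ∫⁻ w, f (M *ᵥ w) = ENNReal.ofReal |M.det⁻¹| * ∫⁻ b, f b := by
  have injective_mulVec : Function.Injective (toLin' M) :=
    mulVec_injective_of_isUnit (M.isUnit_iff_isUnit_det.2 hM.isUnit)
  have measurableEmbedding : MeasurableEmbedding (toLin' M) :=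
    (toLin' M).continuous_of_finiteDimensional.measurableEmbedding injective_mulVec
  rw [← smul_eq_mul, ← lintegral_smul_measure, ← Real.map_matrix_volume_pi_eq_smul_volume_pi hM,
    measurableEmbedding.lintegral_map]
  rfl

theorem ofReal_det_mul_lintegral_comp_mulVec {M : Matrix ι ι ℝ} (hM : 0 < M.det)
    (f : (ι → ℝ) → ENNReal) :
    ENNReal.ofReal M.det * ∫⁻ w, f (M *ᵥ w) = ∫⁻ b, f b := by
  rw [lintegral_comp_mulVec hM.ne', ← mul_assoc, ← ENNReal.ofReal_mul hM.le,
    abs_of_pos (inv_pos.2 hM), mul_inv_cancel₀ hM.ne', ENNReal.ofReal_one, one_mul]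

end LinearChangeOfVariables

section Coordinates

variable {p : ℕ}

theorem symMatrix_apply_of_le (x : UpperIdx p → ℝ) {i j : Fin p} (h : i ≤ j) :
    symMatrix x i j = x ⟨(i, j), h⟩ := by
  simp [symMatrix, h]

/-- The entries of a matrix on and above the diagonal; on symmetric matrices, the inverse of
`symMatrix`. -/
def upperEntries (A : Matrix (Fin p) (Fin p) ℝ) : UpperIdx p → ℝ := fun ij => A ij.1.1 ij.1.2

theorem symMatrix_upperEntries {A : Matrix (Fin p) (Fin p) ℝ} (hA : A.IsSymm) :
    symMatrix (upperEntries A) = A := by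
  obtain ⟨x, rfl, -⟩ := existsUnique_symMatrix A hA
  congr 1
  exact funext fun ij => symMatrix_apply_of_le x ij.2

theorem symMatrix_upperEntries_border (y : UpperIdx p → ℝ) (b : Fin p → ℝ) (s : ℝ) :
    symMatrix (upperEntries (border s b b (symMatrix y))) = border s b b (symMatrix y) :=
  symMatrix_upperEntries (by rw [IsSymm, transpose_border, symMatrix_isSymm y])

theorem continuous_symMatrix : Continuous (symMatrix : (UpperIdx p → ℝ) → _) :=
  continuous_matrix fun _ _ => continuous_apply _

theorem measurableSet_posDefCoords : MeasurableSet (posDefCoords p) := by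
  have eq_inter : posDefCoords p =
      (⋂ v : Fin p → ℝ, {x | 0 ≤ v ⬝ᵥ symMatrix x *ᵥ v}) ∩ {x | (symMatrix x).det ≠ 0} := by
    ext x
    have isHermitian : (symMatrix x).IsHermitian := isHermitian_iff_isSymm.2 (symMatrix_isSymm x)
    simp only [posDefCoords, Set.mem_ofPred_eq, Set.mem_inter_iff, Set.mem_iInter]
    exact ⟨fun h => ⟨h.posSemidef.dotProduct_mulVec_nonneg, h.det_pos.ne'⟩, fun ⟨h, hdet⟩ =>
      (PosSemidef.of_dotProduct_mulVec_nonneg isHermitian h).posDef_iff_det_ne_zero.2 hdet⟩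
  rw [eq_inter]
  refine MeasurableSet.inter (IsClosed.measurableSet ?_) (IsOpen.measurableSet ?_)
  · refine isClosed_iInter fun v => isClosed_le continuous_const ?_
    exact continuous_const.dotProduct (continuous_symMatrix.matrix_mulVec continuous_const)
  · exact isOpen_ne_fun continuous_symMatrix.matrix_det continuous_const

/-- The free entries of a symmetric matrix of size `p + 1`, split into those of its lower block,
the rest of its first row, and its corner; the combinatorial form of `border`. -/
noncomputable def upperIdxSuccEquiv (p : ℕ) : UpperIdx p ⊕ (Fin p ⊕ Unit) ≃ UpperIdx (p + 1) :=
  Equiv.ofBijective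
    (Sum.elim (fun ij => ⟨(ij.1.1.succ, ij.1.2.succ), Fin.succ_le_succ_iff.2 ij.2⟩)
      (Sum.elim (fun j => ⟨(0, j.succ), Fin.zero_le _⟩) fun _ => ⟨(0, 0), le_rfl⟩)) <| by
    constructor
    · rintro (⟨⟨i, j⟩, h⟩ | j | _) (⟨⟨i', j'⟩, h'⟩ | j' | _) <;>
        simp [Fin.succ_ne_zero, (Fin.succ_ne_zero _).symm]
    · rintro ⟨⟨i, j⟩, h⟩
      cases i using Fin.cases with
      | zero =>
        cases j using Fin.cases with
        | zero => exact ⟨.inr (.inr ()), rfl⟩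
        | succ j => exact ⟨.inr (.inl j), rfl⟩
      | succ i =>
        cases j using Fin.cases with
        | zero => exact absurd h (by simp)
        | succ j => exact ⟨.inl ⟨(i, j), Fin.succ_le_succ_iff.1 h⟩, rfl⟩

theorem measurePreserving_upperEntries_border (p : ℕ) :
    MeasurePreserving (fun z : (UpperIdx p → ℝ) × (Fin p → ℝ) × ℝ =>
      upperEntries (border z.2.2 z.2.1 z.2.1 (symMatrix z.1))) := by
  have preserving_reindex := (volume_measurePreserving_piCongrLeft (fun _ => ℝ)
    (upperIdxSuccEquiv p)).comp
      ((volume_measurePreserving_sumPiEquivProdPi_symm fun _ => ℝ).comp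
        ((MeasurePreserving.id volume).prod
          ((volume_measurePreserving_sumPiEquivProdPi_symm fun _ => ℝ).comp
            ((MeasurePreserving.id volume).prod (volume_preserving_funUnique Unit ℝ).symm))))
  convert! preserving_reindex using 1
  ext ⟨y, b, s⟩ ij
  obtain ⟨k, rfl⟩ := (upperIdxSuccEquiv p).surjective ij
  simp only [Function.comp_apply, MeasurableEquiv.piCongrLeft_apply_apply]
  rcases k with ⟨⟨i, j⟩, hij⟩ | j | _
  · exact symMatrix_apply_of_le y hij
  · rfl
  · rfl

theorem lintegral_upperIdx_succ {f : (UpperIdx (p + 1) → ℝ) → ENNReal} (hf : Measurable f) :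
    ∫⁻ x, f x = ∫⁻ y : UpperIdx p → ℝ, ∫⁻ b : Fin p → ℝ, ∫⁻ s : ℝ,
      f (upperEntries (border s b b (symMatrix y))) := by
  have preserving := measurePreserving_upperEntries_border p
  have hf' := hf.comp preserving.measurable
  rw [← preserving.lintegral_comp hf]
  refine (lintegral_prod _ hf'.aemeasurable).trans (lintegral_congr fun y => ?_)
  exact lintegral_prod _ (hf'.comp measurable_prodMk_left).aemeasurable

/-- With `C = symMatrix y`, substitute `b = C w`, of Jacobian `|C|`, in the first row of a bordered
matrix, and then translate its corner by `wᵀ C w`. -/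
theorem setLIntegral_posDefCoords_succ {f : Matrix (Fin (p + 1)) (Fin (p + 1)) ℝ → ENNReal}
    (hf : Measurable fun x => f (symMatrix x)) :
    ∫⁻ x in posDefCoords (p + 1), f (symMatrix x) =
      ∫⁻ y in posDefCoords p, ENNReal.ofReal (symMatrix y).det *
        ∫⁻ w : Fin p → ℝ, ∫⁻ t in Set.Ioi 0, f (schurMatrix t w (symMatrix y)) := by
  classical
  rw [← lintegral_indicator measurableSet_posDefCoords,
    ← lintegral_indicator measurableSet_posDefCoords,
    lintegral_upperIdx_succ (hf.indicator measurableSet_posDefCoords)]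
  simp only [Set.indicator_apply, posDefCoords, Set.mem_ofPred_eq, symMatrix_upperEntries_border]
  refine lintegral_congr fun y => ?_
  split_ifs with hC
  · set C := symMatrix y
    rw [← ofReal_det_mul_lintegral_comp_mulVec hC.det_pos]
    congr 1
    refine lintegral_congr fun w => ?_
    have border_eq (t : ℝ) :
        border (t + w ⬝ᵥ C *ᵥ w) (C *ᵥ w) (C *ᵥ w) C = schurMatrix t w C := by
      rw [schurMatrix_eq_border, ← vecMul_transpose, symMatrix_isSymm y]
    rw [← lintegral_indicator measurableSet_Ioi,
      ← lintegral_add_right_eq_self _ (w ⬝ᵥ C *ᵥ w)]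
    simp only [border_eq, posDef_schurMatrix_iff, hC, and_true, Set.indicator_apply, Set.mem_Ioi]
  · have not_posDef (b : Fin p → ℝ) (s : ℝ) : ¬ (border s b b (symMatrix y)).PosDef :=
      fun h => hC (h.submatrix (Fin.succ_injective p))
    simp [not_posDef]

theorem isPosDefDensity_inv_mul {g : Matrix (Fin p) (Fin p) ℝ → ℝ} {Z : ℝ} (hZ : 0 < Z)
    (hg : ∀ A, A.PosDef → 0 ≤ g A) (hmeas : Measurable fun x => g (symMatrix x))
    (hint : ∫⁻ x in posDefCoords p, ENNReal.ofReal (g (symMatrix x)) = ENNReal.ofReal Z) :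
    IsPosDefDensity fun A => Z⁻¹ * g A := by
  have nonneg_ae : 0 ≤ᵐ[volume.restrict (posDefCoords p)] fun x => g (symMatrix x) := by
    filter_upwards [ae_restrict_mem measurableSet_posDefCoords] with x hx using hg _ hx
  have integral_eq : ∫ x in posDefCoords p, g (symMatrix x) = Z := by
    rw [integral_eq_lintegral_of_nonneg_ae nonneg_ae hmeas.aestronglyMeasurable, hint,
      ENNReal.toReal_ofReal hZ.le]
  have integrableOn : IntegrableOn (fun x => g (symMatrix x)) (posDefCoords p) :=
    .of_integral_ne_zero (integral_eq.trans_ne hZ.ne')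
  refine ⟨fun A hA => mul_nonneg (inv_nonneg.2 hZ.le) (hg A hA), integrableOn.const_mul _, ?_⟩
  rw [integral_const_mul, integral_eq, inv_mul_cancel₀ hZ.ne']

end Coordinates

section GaussianAndGammaIntegrals

theorem lintegral_exp_neg_dotProduct_self (ι : Type*) [Fintype ι] :
    ∫⁻ x : ι → ℝ, ENNReal.ofReal (Real.exp (-(x ⬝ᵥ x))) =
      ENNReal.ofReal (Real.pi ^ ((Fintype.card ι : ℝ) / 2)) := by
  have exp_eq_prod (x : ι → ℝ) : Real.exp (-(x ⬝ᵥ x)) = ∏ i, Real.exp (-1 * x i ^ 2) := by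
    rw [← Real.exp_sum, ← Finset.mul_sum]
    simp [dotProduct, sq]
  have integral_eq : ∫ x : ι → ℝ, Real.exp (-(x ⬝ᵥ x)) = Real.pi ^ ((Fintype.card ι : ℝ) / 2) := by
    simp only [exp_eq_prod]
    rw [integral_fintype_prod_volume_eq_pow fun x : ℝ => Real.exp (-1 * x ^ 2),
      integral_gaussian, div_one, Real.sqrt_eq_rpow, ← Real.rpow_mul_natCast Real.pi_pos.le,
      one_div_mul_eq_div]
  rw [← integral_eq, ofReal_integral_eq_lintegral_ofReal]
  · exact .of_integral_ne_zero (by rw [integral_eq]; positivity)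
  · exact ae_of_all _ fun x => (Real.exp_pos _).le

theorem lintegral_exp_neg_quadraticForm {ι : Type*} [Fintype ι] [DecidableEq ι]
    {G : Matrix ι ι ℝ} (hG : G.PosDef) (x₀ : ι → ℝ) :
    ∫⁻ x : ι → ℝ, ENNReal.ofReal (Real.exp (-((x - x₀) ⬝ᵥ G *ᵥ (x - x₀)))) =
      ENNReal.ofReal (Real.pi ^ ((Fintype.card ι : ℝ) / 2) * G.det ^ (-(1 / 2) : ℝ)) := by
  obtain ⟨M, rfl⟩ : ∃ M : Matrix ι ι ℝ, G = Mᵀ * M := by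
    open scoped MatrixOrder in
    obtain ⟨M, hM⟩ := CStarAlgebra.nonneg_iff_eq_star_mul_self.mp hG.posSemidef.nonneg
    exact ⟨M, by rw [hM, star_eq_conjTranspose, conjTranspose_eq_transpose_of_trivial]⟩
  have det_eq : (Mᵀ * M).det = M.det ^ 2 := by rw [det_mul, det_transpose, sq]
  have hM : M.det ≠ 0 := fun h => hG.det_pos.ne' (by rw [det_eq, h, sq, zero_mul])
  have quadraticForm_eq (x : ι → ℝ) : x ⬝ᵥ (Mᵀ * M) *ᵥ x = M *ᵥ x ⬝ᵥ M *ᵥ x := by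
    rw [← mulVec_mulVec, dotProduct_mulVec, vecMul_transpose]
  have abs_inv_det_eq : |M.det⁻¹| = (Mᵀ * M).det ^ (-(1 / 2) : ℝ) := by
    rw [Real.rpow_neg hG.det_pos.le, ← Real.sqrt_eq_rpow, det_eq, Real.sqrt_sq_eq_abs, abs_inv]
  rw [lintegral_sub_right_eq_self
    (fun x => ENNReal.ofReal (Real.exp (-(x ⬝ᵥ (Mᵀ * M) *ᵥ x)))) x₀]
  simp only [quadraticForm_eq]
  rw [lintegral_comp_mulVec hM fun x => ENNReal.ofReal (Real.exp (-(x ⬝ᵥ x))),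
    lintegral_exp_neg_dotProduct_self, abs_inv_det_eq, mul_comm,
    ← ENNReal.ofReal_mul (by positivity)]

theorem integral_rpow_mul_exp_neg_div_Ioi {a r : ℝ} (ha : 0 < a) (hr : 0 < r) :
    ∫ t in Set.Ioi 0, t ^ (-a - 1) * Real.exp (-(r / t)) = Real.Gamma a * r ^ (-a) := by
  calc ∫ t in Set.Ioi 0, t ^ (-a - 1) * Real.exp (-(r / t))
      = ∫ t in Set.Ioi 0, (|(-1 : ℝ)| * t ^ ((-1 : ℝ) - 1)) •
          ((t ^ (-1 : ℝ)) ^ (a - 1) * Real.exp (-(r * t ^ (-1 : ℝ)))) := by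
        refine setIntegral_congr_fun measurableSet_Ioi fun t (ht : 0 < t) => ?_
        have rpow_eq : t ^ (-a - 1) = t ^ ((-1 : ℝ) - 1) * (t ^ (-1 : ℝ)) ^ (a - 1) := by
          rw [← Real.rpow_mul ht.le, ← Real.rpow_add ht]
          ring_nf
        simp only [rpow_eq, Real.rpow_neg_one, abs_neg, abs_one, one_mul,
          smul_eq_mul, mul_assoc, div_eq_mul_inv]
    _ = ∫ s in Set.Ioi 0, s ^ (a - 1) * Real.exp (-(r * s)) :=
        integral_comp_rpow_Ioi (fun s => s ^ (a - 1) * Real.exp (-(r * s)))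
          (neg_ne_zero.2 one_ne_zero)
    _ = Real.Gamma a * r ^ (-a) := by
        rw [Real.integral_rpow_mul_exp_neg_mul_Ioi ha hr, one_div, Real.inv_rpow hr.le,
          Real.rpow_neg hr.le, mul_comm]

theorem lintegral_rpow_mul_exp_neg_div_Ioi {a r : ℝ} (ha : 0 < a) (hr : 0 < r) :
    ∫⁻ t in Set.Ioi 0, ENNReal.ofReal (t ^ (-a - 1) * Real.exp (-(r / t))) =
      ENNReal.ofReal (Real.Gamma a * r ^ (-a)) := by
  have integral_eq := integral_rpow_mul_exp_neg_div_Ioi ha hr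
  have integral_pos : 0 < Real.Gamma a * r ^ (-a) :=
    mul_pos (Real.Gamma_pos_of_pos ha) (Real.rpow_pos_of_pos hr _)
  rw [← integral_eq, ofReal_integral_eq_lintegral_ofReal]
  · exact .of_integral_ne_zero (integral_eq.trans_ne integral_pos.ne')
  · filter_upwards [ae_restrict_mem measurableSet_Ioi] with t (ht : 0 < t)
    simp only [Pi.zero_apply]
    positivity

theorem lintegral_exp_neg_quadraticForm_div {ι : Type*} [Fintype ι] [DecidableEq ι]
    {D : Matrix ι ι ℝ} (hD : D.PosDef) (w₀ : ι → ℝ) {t : ℝ} (ht : 0 < t) :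
    ∫⁻ w : ι → ℝ, ENNReal.ofReal (Real.exp (-((w - w₀) ⬝ᵥ D *ᵥ (w - w₀) / t))) =
      ENNReal.ofReal (Real.pi ^ ((Fintype.card ι : ℝ) / 2) * D.det ^ (-(1 / 2) : ℝ) *
        t ^ ((Fintype.card ι : ℝ) / 2)) := by
  have det_rpow_eq : (t⁻¹ • D).det ^ (-(1 / 2) : ℝ) =
      D.det ^ (-(1 / 2) : ℝ) * t ^ ((Fintype.card ι : ℝ) / 2) := by
    rw [det_smul, Real.mul_rpow (by positivity) hD.det_pos.le, inv_pow, ← Real.rpow_natCast,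
      ← Real.rpow_neg ht.le, ← Real.rpow_mul ht.le, mul_comm]
    ring_nf
  have h := lintegral_exp_neg_quadraticForm (hD.smul (inv_pos.2 ht)) w₀
  simpa only [smul_mulVec, dotProduct_smul, smul_eq_mul, ← div_eq_inv_mul, det_rpow_eq,
    ← mul_assoc] using h

theorem lintegral_lintegral_rpow_mul_exp_neg_add_quadraticForm_div {ι : Type*} [Fintype ι]
    [DecidableEq ι] {a b : ℝ} (ha : 0 < a) (hb : 0 < b) {D : Matrix ι ι ℝ} (hD : D.PosDef)
    (w₀ : ι → ℝ) :
    ∫⁻ w : ι → ℝ, ∫⁻ t in Set.Ioi 0, ENNReal.ofReal (t ^ (-(a + Fintype.card ι / 2) - 1) *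
        Real.exp (-((b + (w - w₀) ⬝ᵥ D *ᵥ (w - w₀)) / t))) =
      ENNReal.ofReal (Real.pi ^ ((Fintype.card ι : ℝ) / 2) * D.det ^ (-(1 / 2) : ℝ) *
        (Real.Gamma a * b ^ (-a))) := by
  have :
      Measurable fun z : (ι → ℝ) × ℝ => (z.1 - w₀) ⬝ᵥ D *ᵥ (z.1 - w₀) :=
    Continuous.measurable <| (continuous_fst.sub continuous_const).dotProduct
      (continuous_const.matrix_mulVec (continuous_fst.sub continuous_const))
  have gaussianFactor_nonneg :
      0 ≤ Real.pi ^ ((Fintype.card ι : ℝ) / 2) * D.det ^ (-(1 / 2) : ℝ) :=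
    mul_nonneg (by positivity) (Real.rpow_nonneg hD.det_pos.le _)
  rw [lintegral_lintegral_swap (by fun_prop), ENNReal.ofReal_mul gaussianFactor_nonneg,
    ← lintegral_rpow_mul_exp_neg_div_Ioi ha hb,
    ← lintegral_const_mul' _ _ ENNReal.ofReal_ne_top]
  refine setLIntegral_congr_fun measurableSet_Ioi fun t (ht : 0 < t) => ?_
  have rpow_eq : t ^ (-a - 1) =
      t ^ (-(a + Fintype.card ι / 2) - 1) * t ^ ((Fintype.card ι : ℝ) / 2) := by
    rw [← Real.rpow_add ht]
    ring_nf
  have factor_nonneg : 0 ≤ t ^ (-(a + Fintype.card ι / 2) - 1) * Real.exp (-(b / t)) := by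
    positivity
  simp only [add_div b, neg_add, Real.exp_add, ← mul_assoc]
  simp only [← neg_add, ENNReal.ofReal_mul factor_nonneg]
  rw [lintegral_const_mul' _ _ ENNReal.ofReal_ne_top, lintegral_exp_neg_quadraticForm_div hD w₀ ht,
    ← ENNReal.ofReal_mul factor_nonneg, ← ENNReal.ofReal_mul gaussianFactor_nonneg, rpow_eq]
  ring_nf

end GaussianAndGammaIntegrals

section InverseMatrixGamma

variable {p : ℕ}

theorem multivariateGamma_succ (a : ℝ) :
    multivariateGamma (p + 1) a =
      Real.pi ^ ((p : ℝ) / 2) * Real.Gamma a * multivariateGamma p (a - 1 / 2) := by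
  have pi_rpow_eq : Real.pi ^ (((p + 1 : ℕ) : ℝ) * (((p + 1 : ℕ) : ℝ) - 1) / 4) =
      Real.pi ^ ((p : ℝ) / 2) * Real.pi ^ ((p : ℝ) * ((p : ℝ) - 1) / 4) := by
    rw [← Real.rpow_add Real.pi_pos]
    push_cast
    ring_nf
  have argument_eq (j : Fin p) : a - ((j.succ : ℕ) : ℝ) / 2 = a - 1 / 2 - ((j : ℕ) : ℝ) / 2 := by
    push_cast [Fin.val_succ]
    ring
  rw [multivariateGamma, multivariateGamma, pi_rpow_eq, Fin.prod_univ_succ]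
  simp only [argument_eq, Fin.val_zero, Nat.cast_zero, zero_div, sub_zero]
  ring

theorem multivariateGamma_pos {a : ℝ} (ha : ((p : ℝ) - 1) / 2 < a) :
    0 < multivariateGamma p a := by
  refine mul_pos (by positivity) (Finset.prod_pos fun j _ => Real.Gamma_pos_of_pos ?_)
  have : ((j : ℕ) : ℝ) + 1 ≤ p := by exact_mod_cast j.2
  linarith

/-- The density, up to normalization, of the inverse matrix gamma distribution with shape `a` and
scale `B`. The inverse Wishart distribution with `m` degrees of freedom and scale `B` is the case
of shape `m / 2` and scale `B / 2`. -/
noncomputable def inverseMatrixGammaKernel (a : ℝ) (B A : Matrix (Fin p) (Fin p) ℝ) : ℝ :=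
  A.det ^ (-(a + ((p : ℝ) + 1) / 2)) * etr (-(B * A⁻¹))

theorem inverseMatrixGammaKernel_pos (a : ℝ) (B : Matrix (Fin p) (Fin p) ℝ)
    {A : Matrix (Fin p) (Fin p) ℝ} (hA : 0 < A.det) : 0 < inverseMatrixGammaKernel a B A :=
  mul_pos (Real.rpow_pos_of_pos hA _) (Real.exp_pos _)

theorem measurable_inverseMatrixGammaKernel (a : ℝ) (B : Matrix (Fin p) (Fin p) ℝ) :
    Measurable fun x => inverseMatrixGammaKernel a B (symMatrix x) := by
  have measurable_det : Measurable fun x : UpperIdx p → ℝ => (symMatrix x).det :=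
    continuous_symMatrix.matrix_det.measurable
  have measurable_trace : Measurable fun x => (B * (symMatrix x).adjugate).trace :=
    (continuous_const.matrix_mul continuous_symMatrix.matrix_adjugate).matrix_trace.measurable
  simp only [inverseMatrixGammaKernel, etr, inv_def, Ring.inverse_eq_inv, Matrix.mul_smul,
    trace_neg, trace_smul, smul_eq_mul]
  fun_prop

theorem det_mul_inverseMatrixGammaKernel_schurMatrix (a b : ℝ) {t : ℝ} (w₀ w : Fin p → ℝ)
    (D : Matrix (Fin p) (Fin p) ℝ) {C : Matrix (Fin p) (Fin p) ℝ} (ht : 0 < t) (hC : 0 < C.det) :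
    C.det * inverseMatrixGammaKernel a (schurMatrix b w₀ D) (schurMatrix t w C) =
      inverseMatrixGammaKernel (a - 1 / 2) D C * (t ^ (-(a + p / 2) - 1) *
        Real.exp (-((b + (w - w₀) ⬝ᵥ D *ᵥ (w - w₀)) / t))) := by
  have exponent_eq : -(a + (((p + 1 : ℕ) : ℝ) + 1) / 2) = -(a + p / 2) - 1 := by
    push_cast
    ring
  have det_rpow_eq :
      C.det * C.det ^ (-(a + p / 2) - 1) = C.det ^ (-(a - 1 / 2 + ((p : ℝ) + 1) / 2)) := by
    rw [mul_comm, ← Real.rpow_add_one hC.ne']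
    ring_nf
  simp only [inverseMatrixGammaKernel, etr, trace_neg]
  rw [det_schurMatrix, trace_schurMatrix_mul_inv_schurMatrix b w₀ w D ht.ne' hC.ne'.isUnit,
    exponent_eq, Real.mul_rpow ht.le hC.le, ← det_rpow_eq, neg_add (_ / t), Real.exp_add]
  ring

/-- The multiplicativity that drives the induction: integrating out `(t, w)` lowers the shape by
`1 / 2` and replaces the scale `U₀ (b ⊕ D) U₀ᵀ` by `D`. -/
theorem setLIntegral_inverseMatrixGammaKernel_succ {a b : ℝ} (ha : 0 < a) (hb : 0 < b)
    (w₀ : Fin p → ℝ) {D : Matrix (Fin p) (Fin p) ℝ} (hD : D.PosDef) :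
    ∫⁻ x in posDefCoords (p + 1), ENNReal.ofReal
        (inverseMatrixGammaKernel a (schurMatrix b w₀ D) (symMatrix x)) =
      ENNReal.ofReal (Real.pi ^ ((p : ℝ) / 2) * D.det ^ (-(1 / 2) : ℝ) *
          (Real.Gamma a * b ^ (-a))) *
        ∫⁻ y in posDefCoords p,
          ENNReal.ofReal (inverseMatrixGammaKernel (a - 1 / 2) D (symMatrix y)) := by
  rw [setLIntegral_posDefCoords_succ
      (f := fun A => ENNReal.ofReal (inverseMatrixGammaKernel a (schurMatrix b w₀ D) A))
      (measurable_inverseMatrixGammaKernel _ _).ennreal_ofReal,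
    ← lintegral_const_mul' _ _ ENNReal.ofReal_ne_top]
  refine setLIntegral_congr_fun measurableSet_posDefCoords fun y hy => ?_
  have hC : 0 < (symMatrix y).det := PosDef.det_pos hy
  have integrand_eq (w : Fin p → ℝ) :
      ENNReal.ofReal (symMatrix y).det * ∫⁻ t in Set.Ioi 0, ENNReal.ofReal
        (inverseMatrixGammaKernel a (schurMatrix b w₀ D) (schurMatrix t w (symMatrix y))) =
      ENNReal.ofReal (inverseMatrixGammaKernel (a - 1 / 2) D (symMatrix y)) *
        ∫⁻ t in Set.Ioi 0, ENNReal.ofReal (t ^ (-(a + p / 2) - 1) *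
          Real.exp (-((b + (w - w₀) ⬝ᵥ D *ᵥ (w - w₀)) / t))) := by
    rw [← lintegral_const_mul' _ _ ENNReal.ofReal_ne_top,
      ← lintegral_const_mul' _ _ ENNReal.ofReal_ne_top]
    refine setLIntegral_congr_fun measurableSet_Ioi fun t (ht : 0 < t) => ?_
    simp only [← ENNReal.ofReal_mul hC.le,
      ← ENNReal.ofReal_mul (inverseMatrixGammaKernel_pos (a - 1 / 2) D hC).le,
      det_mul_inverseMatrixGammaKernel_schurMatrix a b w₀ w D ht hC]
  have integral_eq := lintegral_lintegral_rpow_mul_exp_neg_add_quadraticForm_div ha hb hD w₀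
  rw [Fintype.card_fin] at integral_eq
  rw [← lintegral_const_mul' _ _ ENNReal.ofReal_ne_top]
  simp only [integrand_eq]
  rw [lintegral_const_mul' _ _ ENNReal.ofReal_ne_top, integral_eq, mul_comm]

theorem setLIntegral_inverseMatrixGammaKernel (p : ℕ) {a : ℝ} (ha : ((p : ℝ) - 1) / 2 < a)
    {B : Matrix (Fin p) (Fin p) ℝ} (hB : B.PosDef) :
    ∫⁻ x in posDefCoords p, ENNReal.ofReal (inverseMatrixGammaKernel a B (symMatrix x)) =
      ENNReal.ofReal (multivariateGamma p a * B.det ^ (-a)) := by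
  induction p generalizing a with
  | zero =>
    have posDefCoords_zero : posDefCoords 0 = Set.univ :=
      Set.eq_univ_of_forall fun x => PosDef.of_dotProduct_mulVec_pos (Subsingleton.elim _ _)
        fun v hv => absurd (Subsingleton.elim _ _) hv
    simp [posDefCoords_zero, inverseMatrixGammaKernel, etr, multivariateGamma, Matrix.trace,
      volume_pi]
  | succ p ih =>
    obtain ⟨b, w₀, D, hb, hD, rfl⟩ := exists_eq_schurMatrix hB
    push_cast at ha
    have a_pos : 0 < a := by linarith [(p.cast_nonneg : (0 : ℝ) ≤ p)]
    have det_pos := hD.det_pos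
    have det_rpow_eq : D.det ^ (-a) = D.det ^ (-(1 / 2) : ℝ) * D.det ^ (-(a - 1 / 2)) := by
      rw [← Real.rpow_add det_pos]
      ring_nf
    have factor_nonneg : 0 ≤ Real.pi ^ ((p : ℝ) / 2) * D.det ^ (-(1 / 2) : ℝ) *
        (Real.Gamma a * b ^ (-a)) := by
      have := Real.Gamma_pos_of_pos a_pos
      positivity
    rw [setLIntegral_inverseMatrixGammaKernel_succ a_pos hb w₀ hD, ih (by linarith) hD,
      ← ENNReal.ofReal_mul factor_nonneg, multivariateGamma_succ, det_schurMatrix,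
      Real.mul_rpow hb.le det_pos.le, det_rpow_eq]
    ring_nf

theorem isPosDefDensity_inverseMatrixGamma {a : ℝ} (ha : ((p : ℝ) - 1) / 2 < a)
    {B : Matrix (Fin p) (Fin p) ℝ} (hB : B.PosDef) :
    IsPosDefDensity fun A =>
      (multivariateGamma p a * B.det ^ (-a))⁻¹ * inverseMatrixGammaKernel a B A :=
  isPosDefDensity_inv_mul
    (mul_pos (multivariateGamma_pos ha) (Real.rpow_pos_of_pos hB.det_pos _))
    (fun _ hA => (inverseMatrixGammaKernel_pos a B hA.det_pos).le)
    (measurable_inverseMatrixGammaKernel a B) (setLIntegral_inverseMatrixGammaKernel p ha hB)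

end InverseMatrixGamma

section ModifiedInvertedWishart

variable {p : ℕ} {n : Fin p → ℝ}

/-- The scale `½ N^{1/2} S N^{1/2}` of the modified inverted Wishart distribution, as an inverse
matrix gamma distribution. -/
noncomputable def miwScale (S : Matrix (Fin p) (Fin p) ℝ) (n : Fin p → ℝ) :
    Matrix (Fin p) (Fin p) ℝ :=
  (1 / 2 : ℝ) • (diagSqrt n * S * diagSqrt n)

/-- The shape `m / 2` of the modified inverted Wishart distribution, as an inverse matrix gamma
distribution, where `m = 2v + tr N / p - p - 1`. -/
noncomputable def miwShape (n : Fin p → ℝ) (v : ℝ) : ℝ :=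
  (2 * v + (Matrix.diagonal n).trace / (p : ℝ) - (p : ℝ) - 1) / 2

theorem det_miwScale (hn : ∀ j, 0 < n j) (S : Matrix (Fin p) (Fin p) ℝ) :
    (miwScale S n).det = (2 ^ p)⁻¹ * (S.det * ∏ j, n j) := by
  rw [miwScale, det_smul, Fintype.card_fin, one_div, inv_pow, det_mul, det_mul, mul_right_comm,
    ← det_mul, diagSqrt_mul_self n hn, det_diagonal, mul_comm S.det]

theorem posDef_miwScale (hn : ∀ j, 0 < n j) {S : Matrix (Fin p) (Fin p) ℝ} (hS : S.PosDef) :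
    (miwScale S n).PosDef := by
  have posDef_diagSqrt : (diagSqrt n).PosDef := .diagonal fun j => Real.sqrt_pos.2 (hn j)
  have posDef_conj := posDef_diagSqrt.isUnit.posDef_star_right_conjugate_iff.2 hS
  rw [star_eq_conjTranspose, posDef_diagSqrt.isHermitian] at posDef_conj
  exact posDef_conj.smul one_half_pos

theorem miwKernel_eq_inverseMatrixGammaKernel (S : Matrix (Fin p) (Fin p) ℝ) (n : Fin p → ℝ)
    (v : ℝ) : miwKernel S n v = inverseMatrixGammaKernel (miwShape n v) (miwScale S n) := by
  funext A
  rw [miwKernel, inverseMatrixGammaKernel, miwScale, miwShape, Matrix.smul_mul, neg_smul]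
  ring_nf

theorem miwConst_eq_inv (hn : ∀ j, 0 < n j) {S : Matrix (Fin p) (Fin p) ℝ} (hS : S.PosDef)
    (v : ℝ) : miwConst S n v =
      (multivariateGamma p (miwShape n v) * (miwScale S n).det ^ (-miwShape n v))⁻¹ := by
  have detS_nonneg : 0 ≤ S.det := hS.det_pos.le
  have prod_nonneg : 0 ≤ ∏ j, n j := Finset.prod_nonneg fun j _ => (hn j).le
  have two_rpow_eq : (2 : ℝ) ^ ((2 * miwShape n v) * (p : ℝ) / 2) =
      (2 ^ p : ℝ) ^ miwShape n v := by
    rw [← Real.rpow_natCast_mul zero_le_two]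
    ring_nf
  have two_mul_miwShape : 2 * v + (Matrix.diagonal n).trace / (p : ℝ) - (p : ℝ) - 1 =
      2 * miwShape n v := by
    rw [miwShape]
    ring
  rw [miwConst, two_mul_miwShape, mul_div_cancel_left₀ _ two_ne_zero, two_rpow_eq,
    det_miwScale hn, Real.rpow_neg (by positivity), Real.mul_rpow (by positivity) (by positivity),
    Real.mul_rpow detS_nonneg prod_nonneg, Real.inv_rpow (by positivity), mul_inv, mul_inv,
    inv_inv]
  ring

end ModifiedInvertedWishart

theorem mainTheorem5 {p : ℕ} (hp : 0 < p) (n : Fin p → ℝ) (hn : ∀ j, 0 < n j)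
    (S : Matrix (Fin p) (Fin p) ℝ) (hS : S.PosDef) (v : ℝ)
    (hv : 2 * (p : ℝ) < 2 * v + (Matrix.diagonal n).trace / (p : ℝ)) :
    0 < miwConst S n v ∧ IsPosDefDensity (fun A => miwConst S n v * miwKernel S n v A) := by
  have hB : (miwScale S n).PosDef := posDef_miwScale hn hS
  have ha : ((p : ℝ) - 1) / 2 < miwShape n v := by
    rw [miwShape]
    linarith
  rw [miwConst_eq_inv hn hS, miwKernel_eq_inverseMatrixGammaKernel]
  exact ⟨inv_pos.2 (mul_pos (multivariateGamma_pos ha) (Real.rpow_pos_of_pos hB.det_pos _)),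
    isPosDefDensity_inverseMatrixGamma ha hB⟩
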